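/- Let $m,n$ be positive integers, and write $M_k(\mathbb{C})$ for the $k\times k$ complex matrices and $M_k^+(\mathbb{C})$ for the positive semidefinite ones. For a linear map $\Phi:M_m(\mathbb{C})\to M_n(\mathbb{C})$ let $\Phi^\dagger:M_n(\mathbb{C})\to M_m(\mathbb{C})$ be its adjoint with respect to the Hilbert–Schmidt inner products $\langle A,B\rangle=\operatorname{tr}[A^*B]$. Call $\Phi$ a *Schwarz map* if $\Phi(K^*K)\ge\Phi(K)^*\Phi(K)$ for all $K\in M_m(\mathbb{C})$ (in the order given by positive semidefiniteness), and *semiunital* if $\Phi^\dagger(\mathbf 1)=\frac{n}{m}\mathbf 1$. **Theorem.** Let $s,t>0$ with $s+t\le 1$, and let $\Phi:M_m(\mathbb{C})\to M_n(\mathbb{C})$ be a semiunital Schwarz map. Then for all $X,Y\in M_n^+(\mathbb{C})$ and all $K\in M_m(\mathbb{C})$, $$\operatorname{tr}\bigl[\Phi(K)^*X^s\Phi(K)Y^t\bigr]\le\left(\frac nm\right)^{1-(s+t)}\operatorname{tr}\bigl[K^*\,\Phi^\dagger(X)^s\,K\,\Phi^\dagger(Y)^t\bigr].$$ -/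

import Mathlib

open scoped Matrix ComplexOrder MatrixOrder

noncomputable section

/-- The adjoint `Φ† : M_n(ℂ) → M_m(ℂ)` of a linear map `Φ : M_m(ℂ) → M_n(ℂ)` for the
Hilbert--Schmidt inner products `⟨A, B⟩ = tr[A* B]`. Its `(i, j)` entry is
`⟨E_ij, Φ†(Y)⟩ = ⟨Φ(E_ij), Y⟩`, with `E_ij` the matrix units; the defining property of the adjoint
and its uniqueness are `hsAdjoint_inner` and `eq_hsAdjoint`. -/
def hsAdjoint {m n : ℕ}
    (Φ : Matrix (Fin m) (Fin m) ℂ →ₗ[ℂ] Matrix (Fin n) (Fin n) ℂ) :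
    Matrix (Fin n) (Fin n) ℂ →ₗ[ℂ] Matrix (Fin m) (Fin m) ℂ where
  toFun Y := Matrix.of fun i j => ((Φ (Matrix.single i j 1))ᴴ * Y).trace
  map_add' Y Z := by
    ext i j
    simp [Matrix.mul_add]
  map_smul' c Y := by
    ext i j
    simp

/-- `⟨Φ†(Y), X⟩ = ⟨Y, Φ(X)⟩` for all `X` and `Y`. -/
theorem hsAdjoint_inner {m n : ℕ}
    (Φ : Matrix (Fin m) (Fin m) ℂ →ₗ[ℂ] Matrix (Fin n) (Fin n) ℂ)
    (Y : Matrix (Fin n) (Fin n) ℂ) (X : Matrix (Fin m) (Fin m) ℂ) :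
    ((hsAdjoint Φ Y)ᴴ * X).trace = (Yᴴ * Φ X).trace := by
  have key : ∀ i j, star (hsAdjoint Φ Y i j) = (Yᴴ * Φ (Matrix.single i j 1)).trace := by
    intro i j
    simp only [hsAdjoint, LinearMap.coe_mk, AddHom.coe_mk, Matrix.of_apply]
    rw [← Matrix.trace_conjTranspose, Matrix.conjTranspose_mul, Matrix.conjTranspose_conjTranspose]
  conv_rhs => rw [Matrix.matrix_eq_sum_single X]
  have h1 : ∀ i j, Φ (Matrix.single i j (X i j)) = X i j • Φ (Matrix.single i j 1) := by
    intro i j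
    rw [← map_smul, Matrix.smul_single, smul_eq_mul, mul_one]
  simp only [map_sum, h1, Matrix.mul_sum, Matrix.trace_sum, Matrix.mul_smul, Matrix.trace_smul,
    ← key, smul_eq_mul]
  simp only [Matrix.trace, Matrix.diag_apply, Matrix.mul_apply, Matrix.conjTranspose_apply]
  rw [Finset.sum_comm]
  exact Finset.sum_congr rfl fun i _ => Finset.sum_congr rfl fun j _ => mul_comm _ _

/-- The adjoint is the only linear map with that property. -/
theorem eq_hsAdjoint {m n : ℕ}
    (Φ : Matrix (Fin m) (Fin m) ℂ →ₗ[ℂ] Matrix (Fin n) (Fin n) ℂ)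
    (Ψ : Matrix (Fin n) (Fin n) ℂ →ₗ[ℂ] Matrix (Fin m) (Fin m) ℂ)
    (h : ∀ Y X, ((Ψ Y)ᴴ * X).trace = (Yᴴ * Φ X).trace) : Ψ = hsAdjoint Φ := by
  ext1 Y
  apply Matrix.conjTranspose_injective
  refine Matrix.ext_iff_trace_mul_right.mpr fun X => ?_
  rw [h, hsAdjoint_inner]

/-- A Schwarz map: a linear map with `Φ(K* K) ≥ Φ(K)* Φ(K)` for all `K`, where `A ≥ B` means that
`A - B` is positive semidefinite. -/
def IsSchwarzMap {m n : ℕ}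
    (Φ : Matrix (Fin m) (Fin m) ℂ →ₗ[ℂ] Matrix (Fin n) (Fin n) ℂ) : Prop :=
  ∀ K : Matrix (Fin m) (Fin m) ℂ, (Φ (Kᴴ * K) - (Φ K)ᴴ * Φ K).PosSemidef

/-- A semiunital map: `Φ†(1) = (n/m) 1`. -/
def IsSemiunital {m n : ℕ}
    (Φ : Matrix (Fin m) (Fin m) ℂ →ₗ[ℂ] Matrix (Fin n) (Fin n) ℂ) : Prop :=
  hsAdjoint Φ 1 = ((n : ℂ) / (m : ℂ)) • (1 : Matrix (Fin m) (Fin m) ℂ)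

end

/-
In the eigenbases of `X` and `Y`, the form `K ↦ tr[K* X^s K Y^t]` is diagonal, with weights
`a^s b^t` where `a`, `b` are the weights of `tr[K* X K]` and `tr[K* K Y]`. The Schwarz inequality,
applied to `K` and to `K*`, bounds these two forms at `Φ(K)` by the corresponding forms of `Φ†(X)`
and `Φ†(Y)` at `K`; semiunitality does the same for `tr[K* K]`, with the factor `n / m`. Such bounds
pass to weighted geometric means of diagonal forms by quadratic interpolation: they pass to parallel
sums, because the parallel sum of two forms is the infimum of `A(u) + B(v)` over the decompositions
`x = u + v`, and the geometric means are integrals of parallel sums.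
-/

open Matrix MeasureTheory Real Set

section ParallelSum

/-- The parallel sum `(a⁻¹ + b⁻¹)⁻¹`, written so that it is `0` where `a` or `b` vanishes. It is
used for nonnegative numbers and, pointwise, for families of weights. -/
def parallelSum {M : Type*} [Mul M] [Add M] [Div M] (a b : M) : M := a * b / (a + b)

theorem parallelSum_mul_norm_add_sq_le {E : Type*} [SeminormedAddCommGroup E] {a b : ℝ}
    (ha : 0 ≤ a) (hb : 0 ≤ b) (u v : E) :
    parallelSum a b * ‖u + v‖ ^ 2 ≤ a * ‖u‖ ^ 2 + b * ‖v‖ ^ 2 := by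
  unfold parallelSum
  rcases (add_nonneg ha hb).eq_or_lt with h | h
  · rw [← h, div_zero, zero_mul]
    positivity
  · calc a * b / (a + b) * ‖u + v‖ ^ 2 ≤ a * b / (a + b) * (‖u‖ + ‖v‖) ^ 2 := by
          gcongr
          exact norm_add_le u v
      _ ≤ a * ‖u‖ ^ 2 + b * ‖v‖ ^ 2 := by
          rw [div_mul_eq_mul_div, div_le_iff₀ h]
          linarith [sq_nonneg (a * ‖u‖ - b * ‖v‖)]

theorem exists_add_eq_parallelSum_mul_norm_sq {E : Type*} [SeminormedAddCommGroup E]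
    [NormedSpace ℝ E] {a b : ℝ} (ha : 0 ≤ a) (hb : 0 ≤ b) (x : E) :
    ∃ u v : E, u + v = x ∧ a * ‖u‖ ^ 2 + b * ‖v‖ ^ 2 = parallelSum a b * ‖x‖ ^ 2 := by
  unfold parallelSum
  rcases (add_nonneg ha hb).eq_or_lt with h | h
  · obtain ⟨rfl, rfl⟩ := (add_eq_zero_iff_of_nonneg ha hb).mp h.symm
    exact ⟨x, 0, by simp⟩
  · refine ⟨(b / (a + b)) • x, (a / (a + b)) • x, ?_, ?_⟩
    · rw [← add_smul, ← add_div, add_comm b a, div_self h.ne', one_smul]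
    · rw [norm_smul_of_nonneg (by positivity), norm_smul_of_nonneg (by positivity)]
      field_simp
      ring

theorem rpow_mul_parallelSum_eqOn {a b p : ℝ} (ha : 0 ≤ a) (hb : 0 ≤ b) (hp : p ∈ Ioo 0 1) :
    EqOn (fun t ↦ t ^ (p - 2) * parallelSum a (t * b))
      (fun t ↦ b * rpowIntegrand₀₁ p t (a / b)) (Ioi 0) := by
  intro t (ht : 0 < t)
  rcases hb.eq_or_lt with rfl | hb
  · simp [parallelSum]
  · have : 0 < a + t * b := by positivity
    have : 0 < t + a / b := by positivity
    simp only [parallelSum]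
    rw [rpowIntegrand₀₁_eq_pow_div hp ht.le (by positivity), show p - 2 = p - 1 - 1 by ring,
      rpow_sub_one ht.ne' (p - 1)]
    field_simp
    ring

theorem integrableOn_rpow_mul_parallelSum {a b p : ℝ} (ha : 0 ≤ a) (hb : 0 ≤ b)
    (hp : p ∈ Ioo 0 1) :
    IntegrableOn (fun t ↦ t ^ (p - 2) * parallelSum a (t * b)) (Ioi 0) :=
  IntegrableOn.congr_fun ((integrableOn_rpowIntegrand₀₁_Ioi hp (div_nonneg ha hb)).const_mul b)
    (rpow_mul_parallelSum_eqOn ha hb hp).symm measurableSet_Ioi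

theorem integral_rpow_mul_parallelSum {a b p : ℝ} (ha : 0 ≤ a) (hb : 0 ≤ b) (hp : p ∈ Ioo 0 1) :
    ∫ t in Ioi 0, t ^ (p - 2) * parallelSum a (t * b) =
      a ^ p * b ^ (1 - p) * ∫ t in Ioi 0, rpowIntegrand₀₁ p t 1 := by
  have hpow : b * (a / b) ^ p = a ^ p * b ^ (1 - p) := by
    rcases hb.eq_or_lt with rfl | hb
    · rw [zero_mul, zero_rpow (sub_pos.mpr hp.2).ne', mul_zero]
    · rw [div_rpow ha hb.le, rpow_sub hb, rpow_one]
      ring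
  rw [setIntegral_congr_fun measurableSet_Ioi (rpow_mul_parallelSum_eqOn ha hb hp),
    integral_const_mul, integral_rpowIntegrand₀₁_eq_rpow_mul_const hp (div_nonneg ha hb),
    ← mul_assoc, hpow]

end ParallelSum

section DiagForm

theorem rpow_div_mul_rpow_div_rpow {ι : Type*} {a b : ι → ℝ} (ha : 0 ≤ a) (hb : 0 ≤ b) {p q : ℝ}
    (hpq : p + q ≠ 0) :
    (a ^ (p / (p + q)) * b ^ (q / (p + q))) ^ (p + q) = a ^ p * b ^ q := by
  ext i
  simp only [Pi.pow_apply, Pi.mul_apply]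
  rw [mul_rpow (rpow_nonneg (ha i) _) (rpow_nonneg (hb i) _), ← rpow_mul (ha i),
    ← rpow_mul (hb i), div_mul_cancel₀ _ hpq, div_mul_cancel₀ _ hpq]

variable {ι κ E F V : Type*} [Fintype ι] [Fintype κ]

/-- The diagonal quadratic form with weights `a`, on vectors with entries in a normed space. -/
def diagForm [Norm E] (a : ι → ℝ) (x : ι → E) : ℝ := ∑ i, a i * ‖x i‖ ^ 2

theorem diagForm_smul [Norm E] (r : ℝ) (a : ι → ℝ) (x : ι → E) :
    diagForm (r • a) x = r * diagForm a x := by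
  simp only [diagForm, Pi.smul_apply, smul_eq_mul, mul_assoc, Finset.mul_sum]

theorem integrableOn_rpow_mul_diagForm_parallelSum [Norm E] {a b : ι → ℝ} (ha : 0 ≤ a)
    (hb : 0 ≤ b) {p : ℝ} (hp : p ∈ Ioo 0 1) (x : ι → E) :
    IntegrableOn (fun t : ℝ ↦ t ^ (p - 2) * diagForm (parallelSum a (t • b)) x) (Ioi 0) := by
  simp only [diagForm, Finset.mul_sum, ← mul_assoc]
  exact integrable_finsetSum _ fun i _ ↦
    (integrableOn_rpow_mul_parallelSum (ha i) (hb i) hp).mul_const _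

theorem integral_rpow_mul_diagForm_parallelSum [Norm E] {a b : ι → ℝ} (ha : 0 ≤ a) (hb : 0 ≤ b)
    {p : ℝ} (hp : p ∈ Ioo 0 1) (x : ι → E) :
    ∫ t in Ioi (0 : ℝ), t ^ (p - 2) * diagForm (parallelSum a (t • b)) x =
      diagForm (a ^ p * b ^ (1 - p)) x * ∫ t in Ioi 0, rpowIntegrand₀₁ p t 1 := by
  simp only [diagForm, Finset.mul_sum, Finset.sum_mul, ← mul_assoc]
  refine (integral_finsetSum _ fun i _ ↦
    (integrableOn_rpow_mul_parallelSum (ha i) (hb i) hp).mul_const _).trans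
    (Finset.sum_congr rfl fun i _ ↦ ?_)
  rw [integral_mul_const, mul_right_comm]
  exact congrArg (· * ‖x i‖ ^ 2) (integral_rpow_mul_parallelSum (ha i) (hb i) hp)

variable [SeminormedAddCommGroup E] [NormedSpace ℝ E] [SeminormedAddCommGroup F] [AddCommMonoid V]
  (e : V ≃+ (ι → E)) (g : V →+ (κ → F)) {a b c : ι → ℝ} {a' b' c' : κ → ℝ}

theorem diagForm_parallelSum_le (ha : 0 ≤ a) (hb : 0 ≤ b) (ha' : 0 ≤ a') (hb' : 0 ≤ b')
    (hga : ∀ x, diagForm a' (g x) ≤ diagForm a (e x))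
    (hgb : ∀ x, diagForm b' (g x) ≤ diagForm b (e x)) (x : V) :
    diagForm (parallelSum a' b') (g x) ≤ diagForm (parallelSum a b) (e x) := by
  choose u v huv hmin using fun i ↦
    exists_add_eq_parallelSum_mul_norm_sq (ha i) (hb i) (e x i)
  have hx : x = e.symm u + e.symm v := by
    rw [← map_add, AddEquiv.eq_symm_apply]
    exact (funext huv).symm
  calc diagForm (parallelSum a' b') (g x)
      = diagForm (parallelSum a' b') (g (e.symm u) + g (e.symm v)) := by rw [hx, map_add]
    _ ≤ diagForm a' (g (e.symm u)) + diagForm b' (g (e.symm v)) := by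
        simp only [diagForm, ← Finset.sum_add_distrib]
        exact Finset.sum_le_sum fun k _ ↦ parallelSum_mul_norm_add_sq_le (ha' k) (hb' k) _ _
    _ ≤ diagForm a u + diagForm b v := by
        simpa only [AddEquiv.apply_symm_apply] using add_le_add (hga (e.symm u)) (hgb (e.symm v))
    _ = diagForm (parallelSum a b) (e x) := by
        simp only [diagForm, ← Finset.sum_add_distrib]
        exact Finset.sum_congr rfl fun i _ ↦ hmin i

theorem diagForm_rpow_mul_rpow_le_of_mem_Ioo (ha : 0 ≤ a) (hb : 0 ≤ b) (ha' : 0 ≤ a')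
    (hb' : 0 ≤ b') (hga : ∀ x, diagForm a' (g x) ≤ diagForm a (e x))
    (hgb : ∀ x, diagForm b' (g x) ≤ diagForm b (e x)) {p : ℝ} (hp : p ∈ Ioo 0 1) (x : V) :
    diagForm (a' ^ p * b' ^ (1 - p)) (g x) ≤ diagForm (a ^ p * b ^ (1 - p)) (e x) := by
  refine le_of_mul_le_mul_right ?_ (integral_rpowIntegrand₀₁_one_pos hp)
  rw [← integral_rpow_mul_diagForm_parallelSum ha hb hp,
    ← integral_rpow_mul_diagForm_parallelSum ha' hb' hp]
  refine setIntegral_mono_on (integrableOn_rpow_mul_diagForm_parallelSum ha' hb' hp _)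
    (integrableOn_rpow_mul_diagForm_parallelSum ha hb hp _) measurableSet_Ioi
    fun t (ht : 0 < t) ↦ ?_
  have hgtb (x : V) : diagForm (t • b') (g x) ≤ diagForm (t • b) (e x) := by
    simpa only [diagForm_smul] using mul_le_mul_of_nonneg_left (hgb x) ht.le
  gcongr
  exact diagForm_parallelSum_le e g ha (smul_nonneg ht.le hb) ha' (smul_nonneg ht.le hb') hga hgtb x

theorem diagForm_rpow_mul_rpow_le (ha : 0 ≤ a) (hb : 0 ≤ b) (ha' : 0 ≤ a') (hb' : 0 ≤ b')
    (hga : ∀ x, diagForm a' (g x) ≤ diagForm a (e x))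
    (hgb : ∀ x, diagForm b' (g x) ≤ diagForm b (e x)) {p q : ℝ} (hp : 0 ≤ p) (hq : 0 ≤ q)
    (hpq : p + q = 1) (x : V) :
    diagForm (a' ^ p * b' ^ q) (g x) ≤ diagForm (a ^ p * b ^ q) (e x) := by
  obtain rfl : q = 1 - p := by linarith
  rcases hp.eq_or_lt with rfl | hp
  · simpa [diagForm] using hgb x
  rcases hq.eq_or_lt with hq | hq
  · obtain rfl : p = 1 := by linarith
    simpa [diagForm] using hga x
  · exact diagForm_rpow_mul_rpow_le_of_mem_Ioo e g ha hb ha' hb' hga hgb ⟨hp, sub_pos.mp hq⟩ x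

theorem diagForm_rpow_mul_rpow_mul_rpow_le (ha : 0 ≤ a) (hb : 0 ≤ b) (hc : 0 ≤ c) (ha' : 0 ≤ a')
    (hb' : 0 ≤ b') (hc' : 0 ≤ c') (hga : ∀ x, diagForm a' (g x) ≤ diagForm a (e x))
    (hgb : ∀ x, diagForm b' (g x) ≤ diagForm b (e x))
    (hgc : ∀ x, diagForm c' (g x) ≤ diagForm c (e x)) {p q r : ℝ} (hp : 0 ≤ p) (hq : 0 ≤ q)
    (hr : 0 ≤ r) (hpqr : p + q + r = 1) (x : V) :
    diagForm (a' ^ p * b' ^ q * c' ^ r) (g x) ≤ diagForm (a ^ p * b ^ q * c ^ r) (e x) := by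
  rcases (add_nonneg hp hq).eq_or_lt with h | h
  · obtain ⟨rfl, rfl⟩ := (add_eq_zero_iff_of_nonneg hp hq).mp h.symm
    obtain rfl : r = 1 := by linarith
    simpa [diagForm] using hgc x
  have hab : 0 ≤ a ^ (p / (p + q)) * b ^ (q / (p + q)) := fun i ↦
    mul_nonneg (rpow_nonneg (ha i) _) (rpow_nonneg (hb i) _)
  have hab' : 0 ≤ a' ^ (p / (p + q)) * b' ^ (q / (p + q)) := fun k ↦
    mul_nonneg (rpow_nonneg (ha' k) _) (rpow_nonneg (hb' k) _)
  have hgab := diagForm_rpow_mul_rpow_le e g ha hb ha' hb' hga hgb (div_nonneg hp h.le)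
    (div_nonneg hq h.le) (by rw [← add_div, div_self h.ne'])
  have hgabc := diagForm_rpow_mul_rpow_le e g hab hc hab' hc' hgab hgc h.le hr hpqr x
  rwa [rpow_div_mul_rpow_div_rpow ha hb h.ne', rpow_div_mul_rpow_div_rpow ha' hb' h.ne'] at hgabc

theorem diagForm_rpow_mul_rpow_le_rpow_mul {r : ℝ} (ha : 0 ≤ a) (hb : 0 ≤ b) (ha' : 0 ≤ a')
    (hb' : 0 ≤ b') (hr : 0 ≤ r) (hga : ∀ x, diagForm a' (g x) ≤ diagForm a (e x))
    (hgb : ∀ x, diagForm b' (g x) ≤ diagForm b (e x))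
    (hgr : ∀ x, diagForm 1 (g x) ≤ r * diagForm 1 (e x)) {p q : ℝ} (hp : 0 ≤ p) (hq : 0 ≤ q)
    (hpq : p + q ≤ 1) (x : V) :
    diagForm (a' ^ p * b' ^ q) (g x) ≤ r ^ (1 - (p + q)) * diagForm (a ^ p * b ^ q) (e x) := by
  have hconst : (r • 1 : ι → ℝ) ^ (1 - (p + q)) = r ^ (1 - (p + q)) • 1 := by
    ext i
    simp
  have hone : (1 : κ → ℝ) ^ (1 - (p + q)) = 1 := by
    ext k
    simp
  have key := diagForm_rpow_mul_rpow_mul_rpow_le e g ha hb (smul_nonneg hr zero_le_one) ha' hb'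
    zero_le_one hga hgb (fun x ↦ (hgr x).trans_eq (diagForm_smul r 1 (e x)).symm) hp hq
    (sub_nonneg.mpr hpq) (add_sub_cancel _ _) x
  rwa [hconst, hone, mul_one, mul_smul_comm, mul_one, diagForm_smul] at key

end DiagForm

section EigenCoords

variable {𝕜 ι κ ι' κ' : Type*} [RCLike 𝕜] [Fintype ι] [Fintype κ] [Fintype ι'] [Fintype κ']

theorem trace_conjTranspose_mul_diagonal_mul_diagonal_eq_diagForm [DecidableEq ι] [DecidableEq κ]
    (K : Matrix ι κ 𝕜) (d : ι → ℝ) (f : κ → ℝ) :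
    (Kᴴ * diagonal (fun i ↦ (d i : 𝕜)) * K * diagonal (fun j ↦ (f j : 𝕜))).trace =
      (diagForm (fun k : ι × κ ↦ d k.1 * f k.2) (Function.uncurry K) : ℝ) := by
  simp only [diagForm, Fintype.sum_prod_type_right, trace, diag_apply, mul_diagonal,
    RCLike.ofReal_sum]
  refine Finset.sum_congr rfl fun j _ ↦ ?_
  rw [mul_apply, Finset.sum_mul]
  refine Finset.sum_congr rfl fun i _ ↦ ?_
  change (Kᴴ * diagonal (fun i ↦ (d i : 𝕜)) : Matrix κ ι 𝕜) j i * K i j * f j =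
    ((d i * f j * ‖K i j‖ ^ 2 : ℝ) : 𝕜)
  rw [mul_diagonal, conjTranspose_apply, RCLike.star_def]
  push_cast
  rw [← RCLike.conj_mul]
  ring

variable [DecidableEq ι] [DecidableEq κ] [DecidableEq ι'] [DecidableEq κ']
  {A : Matrix ι ι 𝕜} {B : Matrix κ κ 𝕜} {A' : Matrix ι' ι' 𝕜} {B' : Matrix κ' κ' 𝕜}

/-- The coordinates of a matrix `K` with respect to the rank-one matrices `u v*`, where `u` and `v`
run over the eigenvector bases of the Hermitian matrices `A` and `B`. -/
noncomputable def eigenCoords (hA : A.IsHermitian) (hB : B.IsHermitian) :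
    Matrix ι κ 𝕜 ≃+ (ι × κ → 𝕜) :=
  let U : Matrix ι ι 𝕜 := hA.eigenvectorUnitary
  let V : Matrix κ κ 𝕜 := hB.eigenvectorUnitary
  have hU : U * Uᴴ = 1 := Unitary.coe_mul_star_self hA.eigenvectorUnitary
  have hU' : Uᴴ * U = 1 := Unitary.coe_star_mul_self hA.eigenvectorUnitary
  have hV : V * Vᴴ = 1 := Unitary.coe_mul_star_self hB.eigenvectorUnitary
  have hV' : Vᴴ * V = 1 := Unitary.coe_star_mul_self hB.eigenvectorUnitary
  { toFun K := Function.uncurry (Uᴴ * K * V)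
    invFun x := U * of (Function.curry x) * Vᴴ
    left_inv K := by
      change U * (Uᴴ * K * V) * Vᴴ = K
      rw [← Matrix.mul_assoc, ← Matrix.mul_assoc, hU, Matrix.one_mul, Matrix.mul_assoc, hV,
        Matrix.mul_one]
    right_inv x := by
      change Function.uncurry (Uᴴ * (U * of (Function.curry x) * Vᴴ) * V) = x
      rw [← Matrix.mul_assoc, ← Matrix.mul_assoc, hU', Matrix.one_mul, Matrix.mul_assoc, hV',
        Matrix.mul_one]
      rfl
    map_add' K L := by
      rw [Matrix.mul_add, Matrix.add_mul]
      rfl }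

theorem trace_conjTranspose_mul_cfc_mul_cfc_eq_diagForm (hA : A.IsHermitian) (hB : B.IsHermitian)
    (f h : ℝ → ℝ) (K : Matrix ι κ 𝕜) :
    (Kᴴ * cfc f A * K * cfc h B).trace =
      (diagForm (f ∘ hA.eigenvalues ∘ Prod.fst * h ∘ hB.eigenvalues ∘ Prod.snd)
        (eigenCoords hA hB K) : ℝ) := by
  let U : Matrix ι ι 𝕜 := hA.eigenvectorUnitary
  let V : Matrix κ κ 𝕜 := hB.eigenvectorUnitary
  let D : Matrix ι ι 𝕜 := diagonal fun i ↦ (f (hA.eigenvalues i) : 𝕜)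
  let F : Matrix κ κ 𝕜 := diagonal fun j ↦ (h (hB.eigenvalues j) : 𝕜)
  have hfA : cfc f A = U * D * Uᴴ := by
    rw [hA.cfc_eq, IsHermitian.cfc, Unitary.conjStarAlgAut_apply]
    rfl
  have hhB : cfc h B = V * F * Vᴴ := by
    rw [hB.cfc_eq, IsHermitian.cfc, Unitary.conjStarAlgAut_apply]
    rfl
  calc (Kᴴ * cfc f A * K * cfc h B).trace
      = ((Uᴴ * K * V)ᴴ * D * (Uᴴ * K * V) * F).trace := by
        rw [hfA, hhB, ← Matrix.mul_assoc, trace_mul_comm _ Vᴴ]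
        simp only [conjTranspose_mul, conjTranspose_conjTranspose, Matrix.mul_assoc]
    _ = _ := trace_conjTranspose_mul_diagonal_mul_diagonal_eq_diagForm _ _ _

theorem trace_conjTranspose_mul_mul_eq_diagForm (hA : A.IsHermitian) (hB : B.IsHermitian)
    (K : Matrix ι κ 𝕜) :
    (Kᴴ * A * K).trace = (diagForm (hA.eigenvalues ∘ Prod.fst) (eigenCoords hA hB K) : ℝ) := by
  simpa [cfc_id ℝ A hA.isSelfAdjoint, cfc_one ℝ B hB.isSelfAdjoint] using
    trace_conjTranspose_mul_cfc_mul_cfc_eq_diagForm hA hB id 1 K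

theorem trace_conjTranspose_mul_self_mul_eq_diagForm (hA : A.IsHermitian) (hB : B.IsHermitian)
    (K : Matrix ι κ 𝕜) :
    (Kᴴ * K * B).trace = (diagForm (hB.eigenvalues ∘ Prod.snd) (eigenCoords hA hB K) : ℝ) := by
  simpa [cfc_one ℝ A hA.isSelfAdjoint, cfc_id ℝ B hB.isSelfAdjoint] using
    trace_conjTranspose_mul_cfc_mul_cfc_eq_diagForm hA hB 1 id K

theorem trace_conjTranspose_mul_self_eq_diagForm (hA : A.IsHermitian) (hB : B.IsHermitian)
    (K : Matrix ι κ 𝕜) :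
    (Kᴴ * K).trace = (diagForm 1 (eigenCoords hA hB K) : ℝ) := by
  simpa [cfc_one ℝ A hA.isSelfAdjoint, cfc_one ℝ B hB.isSelfAdjoint] using
    trace_conjTranspose_mul_cfc_mul_cfc_eq_diagForm hA hB 1 1 K

theorem trace_conjTranspose_mul_rpow_mul_rpow_eq_diagForm (hA : A.PosSemidef) (hB : B.PosSemidef)
    (s t : ℝ) (K : Matrix ι κ 𝕜) :
    (Kᴴ * A ^ s * K * B ^ t).trace =
      (diagForm ((hA.isHermitian.eigenvalues ∘ Prod.fst) ^ s *
        (hB.isHermitian.eigenvalues ∘ Prod.snd) ^ t)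
        (eigenCoords hA.isHermitian hB.isHermitian K) : ℝ) := by
  rw [CFC.rpow_eq_cfc_real hA.nonneg, CFC.rpow_eq_cfc_real hB.nonneg]
  exact trace_conjTranspose_mul_cfc_mul_cfc_eq_diagForm hA.isHermitian hB.isHermitian (· ^ s)
    (· ^ t) K

theorem trace_rpow_mul_rpow_le_of_trace_le (T : Matrix ι κ 𝕜 →+ Matrix ι' κ' 𝕜) {c : ℝ}
    (hA : A.PosSemidef) (hB : B.PosSemidef) (hA' : A'.PosSemidef) (hB' : B'.PosSemidef)
    (hc : 0 ≤ c) (hTA : ∀ K, ((T K)ᴴ * A' * T K).trace ≤ (Kᴴ * A * K).trace)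
    (hTB : ∀ K, ((T K)ᴴ * T K * B').trace ≤ (Kᴴ * K * B).trace)
    (hT : ∀ K, ((T K)ᴴ * T K).trace ≤ (c : 𝕜) * (Kᴴ * K).trace)
    {s t : ℝ} (hs : 0 ≤ s) (ht : 0 ≤ t) (hst : s + t ≤ 1) (K : Matrix ι κ 𝕜) :
    ((T K)ᴴ * A' ^ s * T K * B' ^ t).trace ≤
      ((c ^ (1 - (s + t)) : ℝ) : 𝕜) * (Kᴴ * A ^ s * K * B ^ t).trace := by
  simp only [trace_conjTranspose_mul_mul_eq_diagForm hA.isHermitian hB.isHermitian,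
    trace_conjTranspose_mul_mul_eq_diagForm hA'.isHermitian hB'.isHermitian,
    RCLike.ofReal_le_ofReal] at hTA
  simp only [trace_conjTranspose_mul_self_mul_eq_diagForm hA.isHermitian hB.isHermitian,
    trace_conjTranspose_mul_self_mul_eq_diagForm hA'.isHermitian hB'.isHermitian,
    RCLike.ofReal_le_ofReal] at hTB
  simp only [trace_conjTranspose_mul_self_eq_diagForm hA.isHermitian hB.isHermitian,
    trace_conjTranspose_mul_self_eq_diagForm hA'.isHermitian hB'.isHermitian, ← RCLike.ofReal_mul,
    RCLike.ofReal_le_ofReal] at hT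
  rw [trace_conjTranspose_mul_rpow_mul_rpow_eq_diagForm hA hB,
    trace_conjTranspose_mul_rpow_mul_rpow_eq_diagForm hA' hB', ← RCLike.ofReal_mul,
    RCLike.ofReal_le_ofReal]
  exact diagForm_rpow_mul_rpow_le_rpow_mul (eigenCoords hA.isHermitian hB.isHermitian)
    ((eigenCoords hA'.isHermitian hB'.isHermitian).toAddMonoidHom.comp T)
    (fun k ↦ hA.eigenvalues_nonneg k.1) (fun k ↦ hB.eigenvalues_nonneg k.2)
    (fun k ↦ hA'.eigenvalues_nonneg k.1) (fun k ↦ hB'.eigenvalues_nonneg k.2) hc hTA hTB hT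
    hs ht hst K

end EigenCoords

section Schwarz

theorem trace_mul_nonneg {𝕜 ι : Type*} [RCLike 𝕜] [Fintype ι] {A B : Matrix ι ι 𝕜}
    (hA : A.PosSemidef) (hB : B.PosSemidef) : 0 ≤ (A * B).trace := by
  classical
  obtain ⟨C, rfl⟩ := CStarAlgebra.nonneg_iff_eq_star_mul_self.mp hB.nonneg
  rw [← Matrix.mul_assoc, trace_mul_comm, ← Matrix.mul_assoc]
  exact (hA.mul_mul_conjTranspose_same C).trace_nonneg

theorem posSemidef_of_forall_trace_mul_nonneg {ι : Type*} [Fintype ι] {A : Matrix ι ι ℂ}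
    (h : ∀ B : Matrix ι ι ℂ, B.PosSemidef → 0 ≤ (A * B).trace) : A.PosSemidef := by
  classical
  have hquad (v : ι → ℂ) : 0 ≤ A *ᵥ v ⬝ᵥ star v := by
    simpa only [mul_vecMulVec, trace_vecMulVec] using h _ (posSemidef_vecMulVec_self_star v)
  rw [← isPositive_toEuclideanLin_iff, LinearMap.isPositive_iff_complex]
  intro v
  have hv : 0 ≤ inner ℂ (toEuclideanLin A v) v := by
    rw [← star_nonneg_iff, RCLike.star_def, inner_conj_symm,
      EuclideanSpace.inner_eq_star_dotProduct]
    exact hquad v.ofLp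
  obtain ⟨r, hr, hrv⟩ := RCLike.nonneg_iff_exists_ofReal.mp hv
  rw [← hrv]
  exact ⟨by simp, by simpa using hr⟩

variable {m n : ℕ} {Φ : Matrix (Fin m) (Fin m) ℂ →ₗ[ℂ] Matrix (Fin n) (Fin n) ℂ}

namespace IsSchwarzMap

theorem posSemidef_map (hΦ : IsSchwarzMap Φ) {A : Matrix (Fin m) (Fin m) ℂ} (hA : A.PosSemidef) :
    (Φ A).PosSemidef := by
  obtain ⟨K, rfl⟩ := CStarAlgebra.nonneg_iff_eq_star_mul_self.mp hA.nonneg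
  rw [star_eq_conjTranspose]
  simpa only [sub_add_cancel] using (hΦ K).add (posSemidef_conjTranspose_mul_self (Φ K))

theorem map_conjTranspose (hΦ : IsSchwarzMap Φ) (K : Matrix (Fin m) (Fin m) ℂ) :
    Φ Kᴴ = (Φ K)ᴴ :=
  map_star (PositiveLinearMap.mk₀ Φ fun _ hA ↦ (hΦ.posSemidef_map hA.posSemidef).nonneg) K

theorem trace_hsAdjoint_mul (hΦ : IsSchwarzMap Φ) (X : Matrix (Fin n) (Fin n) ℂ)
    (L : Matrix (Fin m) (Fin m) ℂ) : (hsAdjoint Φ X * L).trace = (X * Φ L).trace := by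
  apply star_injective
  calc star (hsAdjoint Φ X * L).trace = ((hsAdjoint Φ X)ᴴ * Lᴴ).trace := by
        rw [← trace_conjTranspose, conjTranspose_mul, trace_mul_comm]
    _ = (Xᴴ * (Φ L)ᴴ).trace := by rw [hsAdjoint_inner, hΦ.map_conjTranspose]
    _ = star (X * Φ L).trace := by rw [← trace_conjTranspose, conjTranspose_mul, trace_mul_comm]

theorem posSemidef_hsAdjoint (hΦ : IsSchwarzMap Φ) {X : Matrix (Fin n) (Fin n) ℂ}
    (hX : X.PosSemidef) : (hsAdjoint Φ X).PosSemidef := by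
  refine posSemidef_of_forall_trace_mul_nonneg fun B hB ↦ ?_
  rw [hΦ.trace_hsAdjoint_mul]
  exact trace_mul_nonneg hX (hΦ.posSemidef_map hB)

theorem trace_mul_conjTranspose_mul_map_le (hΦ : IsSchwarzMap Φ) {X : Matrix (Fin n) (Fin n) ℂ}
    (hX : X.PosSemidef) (K : Matrix (Fin m) (Fin m) ℂ) :
    ((Φ K)ᴴ * Φ K * X).trace ≤ (Kᴴ * K * hsAdjoint Φ X).trace := by
  rw [trace_mul_comm _ X, trace_mul_comm _ (hsAdjoint Φ X), hΦ.trace_hsAdjoint_mul, ← sub_nonneg,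
    ← trace_sub, ← Matrix.mul_sub]
  exact trace_mul_nonneg hX (hΦ K)

theorem trace_conjTranspose_mul_mul_map_le (hΦ : IsSchwarzMap Φ) {X : Matrix (Fin n) (Fin n) ℂ}
    (hX : X.PosSemidef) (K : Matrix (Fin m) (Fin m) ℂ) :
    ((Φ K)ᴴ * X * Φ K).trace ≤ (Kᴴ * hsAdjoint Φ X * K).trace := by
  rw [trace_mul_cycle, trace_mul_cycle _ (hsAdjoint Φ X)]
  simpa only [hΦ.map_conjTranspose, conjTranspose_conjTranspose] using
    hΦ.trace_mul_conjTranspose_mul_map_le hX Kᴴ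

theorem trace_conjTranspose_mul_map_le (hΦ : IsSchwarzMap Φ) {c : ℂ}
    (hc : hsAdjoint Φ 1 ≤ c • 1) (K : Matrix (Fin m) (Fin m) ℂ) :
    ((Φ K)ᴴ * Φ K).trace ≤ c * (Kᴴ * K).trace :=
  calc ((Φ K)ᴴ * Φ K).trace ≤ (Kᴴ * K * hsAdjoint Φ 1).trace := by
        simpa using hΦ.trace_mul_conjTranspose_mul_map_le PosSemidef.one K
    _ ≤ (Kᴴ * K * c • 1).trace := by
        rw [← sub_nonneg, ← trace_sub, ← Matrix.mul_sub]
        exact trace_mul_nonneg (posSemidef_conjTranspose_mul_self K) (le_iff.mp hc)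
    _ = c * (Kᴴ * K).trace := by simp

end IsSchwarzMap

end Schwarz

theorem theorem3p2_general {m n : ℕ} {s t c : ℝ} (hs : 0 ≤ s) (ht : 0 ≤ t) (hst : s + t ≤ 1)
    (hc : 0 ≤ c) {Φ : Matrix (Fin m) (Fin m) ℂ →ₗ[ℂ] Matrix (Fin n) (Fin n) ℂ}
    (hΦ : IsSchwarzMap Φ) (hΦc : hsAdjoint Φ 1 ≤ (c : ℂ) • 1) {X Y : Matrix (Fin n) (Fin n) ℂ}
    (hX : X.PosSemidef) (hY : Y.PosSemidef) (K : Matrix (Fin m) (Fin m) ℂ) :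
    ((Φ K)ᴴ * X ^ s * Φ K * Y ^ t).trace ≤
      ((c ^ (1 - (s + t)) : ℝ) : ℂ) *
        (Kᴴ * (hsAdjoint Φ X) ^ s * K * (hsAdjoint Φ Y) ^ t).trace :=
  trace_rpow_mul_rpow_le_of_trace_le Φ.toAddMonoidHom (hΦ.posSemidef_hsAdjoint hX)
    (hΦ.posSemidef_hsAdjoint hY) hX hY hc (hΦ.trace_conjTranspose_mul_mul_map_le hX)
    (hΦ.trace_mul_conjTranspose_mul_map_le hY) (hΦ.trace_conjTranspose_mul_map_le hΦc) hs ht hst K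

theorem theorem3p2 (m n : ℕ) (hm : 0 < m) (hn : 0 < n) (s t : ℝ) (hs : 0 < s) (ht : 0 < t)
    (hst : s + t ≤ 1)
    (Φ : Matrix (Fin m) (Fin m) ℂ →ₗ[ℂ] Matrix (Fin n) (Fin n) ℂ)
    (hΦ : IsSchwarzMap Φ) (hΦ' : IsSemiunital Φ)
    (X Y : Matrix (Fin n) (Fin n) ℂ) (hX : X.PosSemidef) (hY : Y.PosSemidef)
    (K : Matrix (Fin m) (Fin m) ℂ) :
    ((Φ K)ᴴ * X ^ s * Φ K * Y ^ t).trace ≤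
      ((((n : ℝ) / (m : ℝ)) ^ (1 - (s + t)) : ℝ) : ℂ) *
        (Kᴴ * (hsAdjoint Φ X) ^ s * K * (hsAdjoint Φ Y) ^ t).trace :=
  theorem3p2_general hs.le ht.le hst (by positivity) hΦ
    (by push_cast; exact hΦ'.le) hX hY K
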